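/- Let $R$ be an associative ring with unity; all modules are left $R$-modules. An embedding $f\colon A\to B$ is an \emph{RD-embedding} if $f[A]\cap rB=rf[A]$ for every $r\in R$, and a \emph{pure embedding} if every finite system of linear equations with parameters in $f[A]$ which has a solution in $B$ has a solution in $f[A]$. Let $\mathcal M$ be one of the following three classes: all embeddings, all RD-embeddings, all pure embeddings. For a submodule $A$ of $B$ write $A\le_{\mathcal M}B$ if the inclusion is in $\mathcal M$; an \emph{$\mathcal M$-epimorphism} is a surjective homomorphism $g\colon B\to C$ with $\ker g\le_{\mathcal M}B$. Let $K$ be a class of $R$-modules which is closed under arbitrary direct sums, under $\mathcal M$-submodules and under $\mathcal M$-epimorphic images, and let $\mathcal K_{\mathcal M}=(K,\le_{\mathcal M})$. A module $E\in K$ is \emph{$\mathcal K_{\mathcal M}$-injective} if for every $\mathcal M$-embedding $f\colon A\to B$ with $A,B\in K$ and every homomorphism $g\colon A\to E$ there is a homomorphism $h\colon B\to E$ with $h\circ f=g$. For a cardinal $\lambda>\operatorname{card}(R)+\aleph_0$, a module $M\in K$ is \emph{$\lambda$-saturated} in $\mathcal K_{\mathcal M}$ if for every $N\in K$ with $N\le_{\mathcal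 M}M$ and $|N|<\lambda$, every $\mu<\lambda$ and every $L\in K$ with $N\le_{\mathcal M}L$ and $|L|\le\mu$, there is an $\mathcal M$-embedding $L\to M$ which is the identity on $N$. A module $E$ is a \emph{retract} of $M$ if there are homomorphisms $i\colon E\to M$ and $\pi\colon M\to E$ with $\pi\circ i=\mathrm{id}_E$. Then: 1. A module $E\in K$ is $\mathcal K_{\mathcal M}$-injective if and only if $E$ is a retract of some $M\in K$ which is $(\operatorname{card}(R)+\aleph_0)^+$-saturated in $\mathcal K_{\mathcal M}$. 2. If $M\in K$ is $\lambda$-saturated in $\mathcal K_{\mathcal M}$ for some $\lambda\ge(\operatorname{card}(R)+\aleph_0)^+$, then $M$ is $\mathcal K_{\mathcal M}$-injective. 3. $\mathcal K_{\mathcal M}$ has enough $\mathcal K_{\mathcal M}$-injectives: for every $A\in K$ there are a $\mathcal K_{\mathcal M}$-injective module $B\in K$ and an $\mathcal M$-embedding $A\to B$. -/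

import Mathlib

universe u

namespace RelInj

open CategoryTheory Cardinal
open scoped DirectSum

/-- The three kinds of embeddings of left modules: embeddings, RD-embeddings, pure embeddings. -/
inductive EmbKind : Type
  | emb
  | rd
  | pure

section Embeddings

variable {R : Type u} [Ring R]
variable {A B C : Type u} [AddCommGroup A] [Module R A] [AddCommGroup B] [Module R B]
  [AddCommGroup C] [Module R C]

/-- `f` is an RD-embedding: it is injective and `f[A] ∩ rB = r f[A]` for every `r`
(the inclusion from right to left is automatic). -/
def IsRDEmbedding (f : A →ₗ[R] B) : Prop :=
  Function.Injective f ∧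
    ∀ (r : R) (b : B), (∃ a : A, f a = r • b) → ∃ a : A, r • f a = r • b

/-- `f` is a pure embedding: it is injective and every finite system of `m` linear equations in
`l` unknowns with parameters in `f[A]` which has a solution in `B` has a solution in `f[A]`. -/
def IsPureEmbedding (f : A →ₗ[R] B) : Prop :=
  Function.Injective f ∧
    ∀ (m l : ℕ) (r : Fin m → Fin l → R) (a : Fin m → A),
      (∃ w : Fin l → B, ∀ j, ∑ i, r j i • w i = f (a j)) →
        ∃ v : Fin l → A, ∀ j, ∑ i, r j i • f (v i) = f (a j)

/-- The class `𝓜` of embeddings of the given kind. -/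
def EmbKind.IsEmbedding : EmbKind → (A →ₗ[R] B) → Prop
  | .emb, f => Function.Injective f
  | .rd, f => IsRDEmbedding f
  | .pure, f => IsPureEmbedding f

/-- `N ≤_𝓜 B` for a submodule `N` of `B`: the inclusion is an `𝓜`-embedding. -/
def EmbKind.IsSubmodule (k : EmbKind) (N : Submodule R B) : Prop :=
  k.IsEmbedding N.subtype

/-- `g` is an `𝓜`-epimorphism: it is the right-hand map of a short exact sequence
`0 → ker g → B → C → 0` whose left-hand map is an `𝓜`-embedding. -/
def EmbKind.IsEpi (k : EmbKind) (g : B →ₗ[R] C) : Prop :=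
  Function.Surjective g ∧ k.IsSubmodule (LinearMap.ker g)

end Embeddings

variable {R : Type u} [Ring R]

/-- A class `K` of left `R`-modules closed under direct sums, `𝓜`-submodules and `𝓜`-epimorphic
images. (Closure under isomorphism is the case of bijective `𝓜`-epimorphisms.) -/
structure IsAdmissible (K : ObjectProperty (ModuleCat.{u} R)) (k : EmbKind) : Prop where
  directSum : ∀ (ι : Type u) (A : ι → ModuleCat.{u} R),
    (∀ i, K (A i)) → K (ModuleCat.of R (⨁ i, A i))
  submodule : ∀ (A : ModuleCat.{u} R) (N : Submodule R A),
    K A → k.IsSubmodule N → K (ModuleCat.of R N)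
  epi : ∀ (A B : ModuleCat.{u} R) (g : A →ₗ[R] B), K A → k.IsEpi g → K B

/-- `E` is `𝒦_𝓜`-injective: every homomorphism `A → E` extends along every `𝓜`-embedding `A → B`
with `A` and `B` in `K`. -/
def IsRelInjective (K : ObjectProperty (ModuleCat.{u} R)) (k : EmbKind)
    (E : ModuleCat.{u} R) : Prop :=
  ∀ (A B : ModuleCat.{u} R), K A → K B → ∀ (f : A →ₗ[R] B), k.IsEmbedding f →
    ∀ g : A →ₗ[R] E, ∃ h : B →ₗ[R] E, h ∘ₗ f = g

/-- `M` is `μ`-universal over its submodule `N` in `(K, ≤_𝓜)`: `N ≤_𝓜 M` in `K`, and every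
extension `L` of `N` in `K` with `|L| ≤ μ` embeds into `M` over `N` by an `𝓜`-embedding. -/
def IsUniversalOver (K : ObjectProperty (ModuleCat.{u} R)) (k : EmbKind) (μ : Cardinal.{u})
    (M : ModuleCat.{u} R) (N : Submodule R M) : Prop :=
  K M ∧ K (ModuleCat.of R N) ∧ k.IsSubmodule N ∧
    ∀ (L : ModuleCat.{u} R) (i : N →ₗ[R] L), K L → #L ≤ μ → k.IsEmbedding i →
      ∃ f : L →ₗ[R] M, k.IsEmbedding f ∧ f ∘ₗ i = N.subtype

/-- `M` is a `κ`-saturated model of `(K, ≤_𝓜)`: it is in `K` and it is `μ`-universal over every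
`N ≤_𝓜 M` with `N` in `K` and `|N| < κ`, for every `μ < κ`. -/
def IsSaturated (K : ObjectProperty (ModuleCat.{u} R)) (k : EmbKind) (κ : Cardinal.{u})
    (M : ModuleCat.{u} R) : Prop :=
  K M ∧ ∀ N : Submodule R M, K (ModuleCat.of R N) → k.IsSubmodule N → #N < κ →
    ∀ μ < κ, IsUniversalOver K k μ M N

end RelInj

/-! Each kind of embedding amounts to injectivity plus reflecting solvability for a set of finite
linear systems: none, the single equations `r • x = a`, or all (`isEmbedding_iff`). Solutions can be
added, subtracted and pushed along homomorphisms, so one argument serves all three kinds.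

Saturated modules are injective. Pushouts along 𝓜-embeddings stay in `K`. To extend a map from a
small module `A` to a small `L`, enclose its image in a small distinguished `N` in `M`, form the
pushout of `L` and `N` over `A`, and let saturation map it to `M` over `N`
(`exists_extension_of_small`). For arbitrary modules, Zorn gives a maximal partial map with
distinguished domain; a Löwenheim–Skolem hull compatible with that domain
(`exists_small_compatible`) reduces adjoining one more element to the small case.

Saturated extensions exist. Representatives of all small extensions form a set and can be
amalgamated over `M` at once (`exists_universal_extension`). Iterating this along a regular
successor cardinal suffices, since a small submodule of the union already lies in some stage.
Finally, an injective module splits off its saturated extension, and retracts of injectives are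
injective. -/

namespace RelInj

open CategoryTheory Cardinal
open scoped DirectSum

/-! ### Embeddings as maps reflecting solvability of linear systems -/

section Systems

variable {R : Type u} [Ring R]

/-- The left-hand side of a finite system of linear equations: the number of equations, the number
of unknowns, and the coefficients. -/
abbrev LinSystem (R : Type u) : Type u := Σ m : ℕ, Σ l : ℕ, Fin m → Fin l → R

/-- The additive map sending a tuple of values for the unknowns to the tuple of right-hand sides. -/
def LinSystem.eval (s : LinSystem R) {A : Type*} [AddCommGroup A] [Module R A] :
    (Fin s.2.1 → A) →+ (Fin s.1 → A) where
  toFun w j := ∑ i, s.2.2 j i • w i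
  map_zero' := by ext; simp
  map_add' v w := by ext; simp [Finset.sum_add_distrib]

lemma LinSystem.eval_apply (s : LinSystem R) {A : Type*} [AddCommGroup A] [Module R A]
    (w : Fin s.2.1 → A) (j : Fin s.1) : s.eval w j = ∑ i, s.2.2 j i • w i := rfl

lemma LinSystem.eval_map (s : LinSystem R) {A B : Type*} [AddCommGroup A] [Module R A]
    [AddCommGroup B] [Module R B] (f : A →ₗ[R] B) (w : Fin s.2.1 → A) (j : Fin s.1) :
    s.eval (fun i => f (w i)) j = f (s.eval w j) := by
  simp [LinSystem.eval_apply]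

lemma LinSystem.eval_single (r : R) {A : Type*} [AddCommGroup A] [Module R A] (w : Fin 1 → A)
    (j : Fin 1) : LinSystem.eval (⟨1, 1, fun _ _ => r⟩ : LinSystem R) w j = r • w 0 :=
  Fin.sum_univ_one fun i => r • w i

/-- The systems of equations whose solvability is reflected by the embeddings of a given kind. -/
def EmbKind.systems (R : Type u) : EmbKind → Set (LinSystem R)
  | .emb => ∅
  | .rd => Set.range fun r => ⟨1, 1, fun _ _ => r⟩
  | .pure => Set.univ

variable {A B C : Type u} [AddCommGroup A] [Module R A] [AddCommGroup B] [Module R B]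
  [AddCommGroup C] [Module R C] {k : EmbKind}

/-- Injectivity lets the equations be checked in `A` instead of `f[A]`; the RD condition is the case
of one equation in one unknown. -/
lemma EmbKind.isEmbedding_iff (f : A →ₗ[R] B) :
    k.IsEmbedding f ↔ Function.Injective f ∧ ∀ s ∈ k.systems R, ∀ (a : Fin s.1 → A)
      (w : Fin s.2.1 → B), (∀ j, s.eval w j = f (a j)) → ∃ v, ∀ j, s.eval v j = a j := by
  cases k with
  | emb => simp [EmbKind.IsEmbedding, EmbKind.systems]
  | rd =>
    refine and_congr_right fun hf => ⟨?_, fun h r b ⟨a, ha⟩ => ?_⟩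
    · rintro h _ ⟨r, rfl⟩ a w hw
      obtain ⟨c, hc⟩ := h r (w 0) ⟨a 0, (hw 0).symm.trans (LinSystem.eval_single r w 0)⟩
      refine ⟨fun _ => c, fun j => hf ?_⟩
      rw [← hw j, LinSystem.eval_single r (fun _ => c) j, map_smul, hc]
      exact (LinSystem.eval_single r w j).symm
    · obtain ⟨v, hv⟩ := h _ ⟨r, rfl⟩ (fun _ => a) (fun _ => b)
        fun j => (LinSystem.eval_single r (fun _ => b) j).trans ha.symm
      have : r • v 0 = a := (LinSystem.eval_single r v 0).symm.trans (hv 0)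
      exact ⟨v 0, by rw [← map_smul, this, ha]⟩
  | pure =>
    refine and_congr_right fun hf => ⟨fun h s _ a w hw => ?_, fun h m l r a ⟨w, hw⟩ => ?_⟩
    · obtain ⟨v, hv⟩ := h s.1 s.2.1 s.2.2 a ⟨w, hw⟩
      exact ⟨v, fun j => hf <| by rw [← hv j, ← s.eval_map]; rfl⟩
    · obtain ⟨v, hv⟩ := h ⟨m, l, r⟩ trivial a w hw
      refine ⟨v, fun j => ?_⟩
      rw [← hv j]
      exact LinSystem.eval_map ⟨m, l, r⟩ f v j

lemma EmbKind.IsEmbedding.injective {f : A →ₗ[R] B} (hf : k.IsEmbedding f) :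
    Function.Injective f := (k.isEmbedding_iff f).1 hf |>.1

lemma EmbKind.IsEmbedding.exists_eval_eq {f : A →ₗ[R] B} (hf : k.IsEmbedding f)
    {s : LinSystem R} (hs : s ∈ k.systems R) (a : Fin s.1 → A) (w : Fin s.2.1 → B)
    (h : ∀ j, s.eval w j = f (a j)) : ∃ v, ∀ j, s.eval v j = a j :=
  ((k.isEmbedding_iff f).1 hf).2 s hs a w h

lemma EmbKind.isEmbedding_of_equiv (e : A ≃ₗ[R] B) : k.IsEmbedding (e : A →ₗ[R] B) := by
  refine (k.isEmbedding_iff _).2 ⟨e.injective, fun s _ a w hw => ⟨fun i => e.symm (w i), fun j => ?_⟩⟩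
  exact (s.eval_map (e.symm : B →ₗ[R] A) w j).trans (by rw [hw j]; simp)

lemma EmbKind.IsEmbedding.comp {g : B →ₗ[R] C} {f : A →ₗ[R] B} (hg : k.IsEmbedding g)
    (hf : k.IsEmbedding f) : k.IsEmbedding (g ∘ₗ f) := by
  refine (k.isEmbedding_iff _).2 ⟨hg.injective.comp hf.injective, fun s hs a w hw => ?_⟩
  obtain ⟨v, hv⟩ := hg.exists_eval_eq hs (fun j => f (a j)) w hw
  exact hf.exists_eval_eq hs a v hv

lemma EmbKind.IsEmbedding.of_comp {g : B →ₗ[R] C} {f : A →ₗ[R] B}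
    (h : k.IsEmbedding (g ∘ₗ f)) : k.IsEmbedding f := by
  refine (k.isEmbedding_iff _).2
    ⟨Function.Injective.of_comp (f := g) h.injective, fun s hs a w hw => ?_⟩
  exact h.exists_eval_eq hs a (fun i => g (w i)) fun j => by rw [s.eval_map, hw j]; rfl

lemma EmbKind.isSubmodule_iff (N : Submodule R B) :
    k.IsSubmodule N ↔ ∀ s ∈ k.systems R, ∀ (a : Fin s.1 → B) (w : Fin s.2.1 → B),
      (∀ j, a j ∈ N) → (∀ j, s.eval w j = a j) → ∃ v, (∀ i, v i ∈ N) ∧ ∀ j, s.eval v j = a j := by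
  refine (k.isEmbedding_iff _).trans ⟨fun h s hs a w ha hw => ?_, fun h => ⟨N.subtype_injective, ?_⟩⟩
  · obtain ⟨v, hv⟩ := h.2 s hs (fun j => ⟨a j, ha j⟩) w hw
    exact ⟨fun i => v i, fun i => (v i).2, fun j =>
      (s.eval_map N.subtype v j).trans (congrArg N.subtype (hv j))⟩
  · intro s hs a w hw
    obtain ⟨v, hv, hva⟩ := h s hs (fun j => a j) w (fun j => (a j).2) hw
    exact ⟨fun i => ⟨v i, hv i⟩, fun j => Subtype.ext <|
      (s.eval_map N.subtype (fun i => ⟨v i, hv i⟩) j).symm.trans (hva j)⟩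

lemma EmbKind.IsEmbedding.isSubmodule_range {f : A →ₗ[R] B} (hf : k.IsEmbedding f) :
    k.IsSubmodule (LinearMap.range f) := by
  have h := hf.comp (k.isEmbedding_of_equiv (LinearEquiv.ofInjective f hf.injective).symm)
  have e : f ∘ₗ ((LinearEquiv.ofInjective f hf.injective).symm : _ →ₗ[R] A) =
      (LinearMap.range f).subtype := by
    ext ⟨_, x, rfl⟩
    exact congrArg f ((LinearEquiv.symm_apply_eq _).2 (Subtype.ext rfl))
  exact (congrArg k.IsEmbedding e).mp h

/-- The kernel is zero, and a system with zero right-hand side has the zero solution. Hence `K` is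
closed under isomorphism. -/
lemma EmbKind.isEpi_of_equiv (e : A ≃ₗ[R] B) : k.IsEpi (e : A →ₗ[R] B) := by
  refine ⟨e.surjective, (k.isSubmodule_iff _).2 fun s _ a w ha hw => ⟨0, by simp, fun j => ?_⟩⟩
  have : a j = 0 := by simpa using ha j
  simp [this]

end Systems

/-! ### Binary products and pushouts in `K` -/

section Closure

variable {R : Type u} [Ring R] {K : ObjectProperty (ModuleCat.{u} R)} {k : EmbKind}
variable {A B C : Type u} [AddCommGroup A] [Module R A] [AddCommGroup B] [Module R B]
  [AddCommGroup C] [Module R C]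

lemma IsAdmissible.of_equiv (hK : IsAdmissible K k) (e : A ≃ₗ[R] B)
    (hA : K (ModuleCat.of R A)) : K (ModuleCat.of R B) :=
  hK.epi (ModuleCat.of R A) (ModuleCat.of R B) e hA (k.isEpi_of_equiv e)

lemma IsAdmissible.prod (hK : IsAdmissible K k) (hA : K (ModuleCat.of R A))
    (hB : K (ModuleCat.of R B)) : K (ModuleCat.of R (A × B)) := by
  let X : ULift.{u} Bool → ModuleCat.{u} R := fun b => bif b.down then .of R A else .of R B
  have hX : ∀ b, K (X b) := by rintro ⟨_ | _⟩; exacts [hB, hA]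
  let f : (⨁ b, X b) →ₗ[R] A × B := DirectSum.toModule R _ _ fun b => match b with
    | ⟨true⟩ => LinearMap.inl R A B
    | ⟨false⟩ => LinearMap.inr R A B
  let g : A × B →ₗ[R] ⨁ b, X b := LinearMap.coprod
    (DirectSum.lof R (ULift Bool) (fun b => X b) ⟨true⟩)
    (DirectSum.lof R (ULift Bool) (fun b => X b) ⟨false⟩)
  refine hK.of_equiv (A := ⨁ b, X b) (LinearEquiv.ofLinearMap f g ?_ ?_) (hK.directSum _ X hX)
  · refine LinearMap.prod_ext (LinearMap.ext fun x => ?_) (LinearMap.ext fun x => ?_)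
    · have : f (DirectSum.lof R (ULift Bool) (fun b => X b) ⟨true⟩ x) = (x, 0) :=
        DirectSum.toModule_lof ..
      simpa [g] using this
    · have : f (DirectSum.lof R (ULift Bool) (fun b => X b) ⟨false⟩ x) = (0, x) :=
        DirectSum.toModule_lof ..
      simpa [g] using this
  · refine DirectSum.linearMap_ext R fun b => LinearMap.ext fun x => ?_
    rw [LinearMap.comp_apply, LinearMap.comp_apply, DirectSum.toModule_lof]
    rcases b with ⟨_ | _⟩
    · change DirectSum.lof R (ULift Bool) (fun b => X b) ⟨true⟩ (0 : A) +
        DirectSum.lof R (ULift Bool) (fun b => X b) ⟨false⟩ x = _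
      exact (congrArg (· + _) (map_zero _)).trans (zero_add _)
    · change DirectSum.lof R (ULift Bool) (fun b => X b) ⟨true⟩ x +
        DirectSum.lof R (ULift Bool) (fun b => X b) ⟨false⟩ (0 : B) = _
      exact (congrArg (_ + ·) (map_zero _)).trans (add_zero _)

/-- The submodule of `B × C` whose quotient is the pushout of `f` and `g`. -/
abbrev pushoutKer (f : A →ₗ[R] B) (g : A →ₗ[R] C) : Submodule R (B × C) :=
  LinearMap.range (f.prod (-g))

/-- The pushout of `f` and `g`. -/
abbrev Pushout (f : A →ₗ[R] B) (g : A →ₗ[R] C) : Type u := (B × C) ⧸ pushoutKer f g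

/-- The left leg of the pushout. -/
def Pushout.inl (f : A →ₗ[R] B) (g : A →ₗ[R] C) : B →ₗ[R] Pushout f g :=
  (pushoutKer f g).mkQ ∘ₗ LinearMap.inl R B C

/-- The right leg of the pushout. -/
def Pushout.inr (f : A →ₗ[R] B) (g : A →ₗ[R] C) : C →ₗ[R] Pushout f g :=
  (pushoutKer f g).mkQ ∘ₗ LinearMap.inr R B C

lemma Pushout.inl_comp (f : A →ₗ[R] B) (g : A →ₗ[R] C) (a : A) :
    Pushout.inl f g (f a) = Pushout.inr f g (g a) := by
  refine (Submodule.Quotient.eq _).2 ⟨a, ?_⟩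
  simp

lemma Pushout.mkQ_eq_iff (f : A →ₗ[R] B) (g : A →ₗ[R] C) (x y : B × C) :
    (pushoutKer f g).mkQ x = (pushoutKer f g).mkQ y ↔
      ∃ a, x.1 = y.1 + f a ∧ x.2 = y.2 - g a := by
  refine (Submodule.Quotient.eq _).trans (exists_congr fun a => ?_)
  rw [Prod.ext_iff, eq_comm, @eq_comm _ (f.prod (-g) a).2]
  change x.1 - y.1 = f a ∧ x.2 - y.2 = -g a ↔ _
  rw [sub_eq_iff_eq_add', sub_eq_iff_eq_add', ← sub_eq_add_neg]

lemma EmbKind.IsEmbedding.prod {f : A →ₗ[R] B} (hf : k.IsEmbedding f) (g : A →ₗ[R] C) :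
    k.IsEmbedding (f.prod g) :=
  EmbKind.IsEmbedding.of_comp (g := LinearMap.fst R B C) (by rwa [LinearMap.fst_prod])

/-- The kernel of `B × C → Pushout f g` is the image of `f.prod (-g)`, an 𝓜-embedding because its
first component is one. -/
lemma IsAdmissible.pushout (hK : IsAdmissible K k) {f : A →ₗ[R] B} (hf : k.IsEmbedding f)
    (g : A →ₗ[R] C) (hB : K (ModuleCat.of R B)) (hC : K (ModuleCat.of R C)) :
    K (ModuleCat.of R (Pushout f g)) := by
  refine hK.epi (ModuleCat.of R (B × C)) (ModuleCat.of R (Pushout f g)) (pushoutKer f g).mkQ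
    (hK.prod hB hC) ⟨Submodule.mkQ_surjective _, ?_⟩
  rw [Submodule.ker_mkQ]
  exact (hf.prod _).isSubmodule_range

lemma EmbKind.IsEmbedding.pushout_inr {f : A →ₗ[R] B} (hf : k.IsEmbedding f) (g : A →ₗ[R] C) :
    k.IsEmbedding (Pushout.inr f g) := by
  refine (k.isEmbedding_iff _).2 ⟨(injective_iff_map_eq_zero _).2 fun c hc => ?_, ?_⟩
  · obtain ⟨a, h₁, h₂⟩ := (Pushout.mkQ_eq_iff f g (0, c) 0).1 (hc.trans (map_zero _).symm)
    have : a = 0 := hf.injective (by simpa using h₁.symm)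
    simpa [this] using h₂
  · intro s hs c w hw
    -- Lift the solution to `B × C`. The lift errs by `(f a, -g a)`; solving for `a` inside `A` and
    -- adding the `g`-image to the `C`-component cancels the error.
    choose w' hw' using fun i => Submodule.mkQ_surjective (pushoutKer f g) (w i)
    have key : ∀ j, ∃ a, (s.eval w' j).1 = 0 + f a ∧ (s.eval w' j).2 = c j - g a := fun j =>
      (Pushout.mkQ_eq_iff f g _ (0, c j)).1 <| by
        rw [← s.eval_map, funext hw', hw j]; rfl
    choose a h₁ h₂ using key
    obtain ⟨v, hv⟩ := hf.exists_eval_eq hs a (fun i => (w' i).1) fun j =>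
      (s.eval_map (LinearMap.fst R B C) w' j).trans (by simpa using h₁ j)
    refine ⟨(fun i => (w' i).2) + fun i => g (v i), fun j => ?_⟩
    rw [map_add, Pi.add_apply, s.eval_map, hv]
    rw [show s.eval (fun i => (w' i).2) j = c j - g (a j) from
      (s.eval_map (LinearMap.snd R B C) w' j).trans (h₂ j), sub_add_cancel]

end Closure

/-! ### Simultaneous amalgamation of a family of extensions -/

section Amalgam

variable {R : Type u} [Ring R] {k : EmbKind} {I : Type u} {N L : I → Type u} {M : Type u}
  [∀ i, AddCommGroup (N i)] [∀ i, Module R (N i)] [∀ i, AddCommGroup (L i)] [∀ i, Module R (L i)]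
  [AddCommGroup M] [Module R M]

lemma EmbKind.IsEmbedding.lmap {b : ∀ i, N i →ₗ[R] L i} (hb : ∀ i, k.IsEmbedding (b i)) :
    k.IsEmbedding (DirectSum.lmap b) := by
  classical
  refine (k.isEmbedding_iff _).2 ⟨(DirectSum.lmap_injective b).2 fun i => (hb i).injective, ?_⟩
  intro s hs a w hw
  have key : ∀ i, ∃ v : Fin s.2.1 → N i, ∀ j, s.eval v j = a j i := fun i =>
    (hb i).exists_eval_eq hs (fun j => a j i) (fun t => w t i) fun j =>
      (s.eval_map (DirectSum.component R I L i) w j).trans <| by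
        rw [hw j]; rfl
  choose v hv using key
  let T : Finset I := Finset.univ.biUnion fun j => (a j).support
  -- Outside the finite set `T` every right-hand side vanishes, so the componentwise solutions may
  -- be replaced by zero there.
  refine ⟨fun t => DFinsupp.mk T fun i => v i t, fun j => DFinsupp.ext fun i => ?_⟩
  refine (s.eval_map (DirectSum.component R I N i)
    (fun t => (DFinsupp.mk T fun i => v i t : ⨁ i, N i)) j).symm.trans ?_
  by_cases hi : i ∈ T
  · rw [← hv i j]
    exact congrArg (fun w => s.eval w j) (funext fun t => DFinsupp.mk_of_mem (β := N) (x := fun i => v i t) hi)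
  · have h0 : a j i = 0 := by
      by_contra h
      exact hi (Finset.mem_biUnion.2 ⟨j, Finset.mem_univ j, DFinsupp.mem_support_iff.2 h⟩)
    have h1 : (fun t => DirectSum.component R I N i (DFinsupp.mk T fun i => v i t : ⨁ i, N i)) =
        (0 : Fin s.2.1 → N i) := 
      funext fun t => DFinsupp.mk_of_notMem (β := N) (x := fun i => v i t) hi
    rw [h0, h1, map_zero, Pi.zero_apply]

/-- Amalgamating a family of embeddings `b i : N i → L i` over embeddings `a i : N i → M`, each
`L i` embeds into the result. -/
lemma EmbKind.IsEmbedding.amalgam [DecidableEq I] {a : ∀ i, N i →ₗ[R] M} {b : ∀ i, N i →ₗ[R] L i}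
    (hb : ∀ i, k.IsEmbedding (b i)) (i : I) (ha : k.IsEmbedding (a i)) :
    k.IsEmbedding (Pushout.inl (DirectSum.lmap b) (DirectSum.toModule R I M a) ∘ₗ
      DirectSum.lof R I L i) := by
  classical
  set f := DirectSum.lmap b
  set g := DirectSum.toModule R I M a
  have hf : Function.Injective f := (EmbKind.IsEmbedding.lmap hb).injective
  have hf_apply : ∀ n j, f n j = b j (n j) := fun n j => rfl
  refine (k.isEmbedding_iff _).2 ⟨(injective_iff_map_eq_zero _).2 fun x hx => ?_, ?_⟩
  · obtain ⟨n, h₁, h₂⟩ := (Pushout.mkQ_eq_iff f g (DirectSum.lof R I L i x, 0) 0).1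
      (hx.trans (map_zero _).symm)
    simp only [Prod.fst_zero, Prod.snd_zero, zero_add, zero_sub] at h₁ h₂
    -- Injectivity of the other `b j` concentrates `n` in degree `i`, where injectivity of `a i`
    -- then kills it.
    have hn : n = DirectSum.lof R I N i (n i) := by
      refine DFinsupp.ext fun j => ?_
      rcases eq_or_ne i j with rfl | hij
      · exact (DirectSum.lof_apply R i (n i)).symm
      · refine (hb j).injective ?_
        rw [← hf_apply, ← h₁, DirectSum.lof_eq_of, DirectSum.lof_eq_of,
          DirectSum.of_eq_of_ne _ _ _ hij.symm, DirectSum.of_eq_of_ne _ _ _ hij.symm, map_zero]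
    have h3 : a i (n i) = 0 := by
      rw [hn, DirectSum.toModule_lof] at h₂
      simpa using h₂.symm
    have h4 : n i = 0 := ha.injective (by rw [h3, map_zero])
    have h5 := congrArg (fun d : ⨁ i, L i => d i) h₁
    simp only [hf_apply, h4, map_zero] at h5
    rwa [DirectSum.lof_apply] at h5
  · intro s hs x w hw
    choose w' hw' using fun t => Submodule.mkQ_surjective (pushoutKer f g) (w t)
    have key : ∀ j, ∃ n, (s.eval w' j).1 = DirectSum.lof R I L i (x j) + f n ∧
        (s.eval w' j).2 = 0 - g n := fun j =>
      (Pushout.mkQ_eq_iff f g _ (DirectSum.lof R I L i (x j), 0)).1 <| by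
        rw [← s.eval_map, funext hw', hw j]; rfl
    choose n h₁ h₂ using key
    have h1' : ∀ j, s.eval (fun t => (w' t).1) j = DirectSum.lof R I L i (x j) + f (n j) := fun j =>
      (s.eval_map (LinearMap.fst R _ M) w' j).trans (h₁ j)
    have h2' : ∀ j, s.eval (fun t => (w' t).2) j = - g (n j) := fun j =>
      (s.eval_map (LinearMap.snd R _ M) w' j).trans (by simpa using h₂ j)
    -- solve the components away from `i` inside the `N j`
    let n' : Fin s.1 → ⨁ i, N i := fun j => n j - DirectSum.lof R I N i (n j i)
    have hfn' : ∀ j, s.eval (fun t => (w' t).1 - DirectSum.lof R I L i ((w' t).1 i)) j = f (n' j) := by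
      intro j
      have e1 := s.eval_map (DirectSum.lof R I L i ∘ₗ DirectSum.component R I L i)
        (fun t => (w' t).1) j
      have e2 := map_sub s.eval (fun t => (w' t).1)
        (fun t => (DirectSum.lof R I L i ∘ₗ DirectSum.component R I L i) (w' t).1)
      refine (congrFun e2 j).trans ?_
      rw [Pi.sub_apply, e1, h1', LinearMap.comp_apply, map_add, map_add]
      have e3 : DirectSum.component R I L i (DirectSum.lof R I L i (x j)) = x j :=
        DirectSum.component.lof_self R i (x j)
      have e4 : DirectSum.component R I L i (f (n j)) = b i (n j i) := rfl
      have e5 : f (DirectSum.lof R I N i (n j i)) = DirectSum.lof R I L i (b i (n j i)) :=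
        DirectSum.lmap_lof ..
      rw [e3, e4, map_sub, e5]
      abel
    obtain ⟨v, hv⟩ := (EmbKind.IsEmbedding.lmap hb).exists_eval_eq hs n' _ hfn'
    have hgn' : ∀ j, g (n j) = g (n' j) + a i (n j i) := fun j => by
      rw [map_sub, DirectSum.toModule_lof, sub_add_cancel]
    -- Moving `v` across to `M` leaves a system with right-hand side `a i (n j i)`, which `ha`
    -- solves in `N i`. Subtracting `b i (y t)` below removes the remaining error in `L i`.
    obtain ⟨y, hy⟩ := ha.exists_eval_eq hs (fun j => n j i)
      (-((fun t => (w' t).2) + fun t => g (v t))) fun j => by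
        rw [map_neg, map_add, Pi.neg_apply, Pi.add_apply, h2', s.eval_map, hv, hgn']
        abel
    refine ⟨(fun t => (w' t).1 i) - fun t => b i (y t), fun j => ?_⟩
    rw [map_sub, Pi.sub_apply, s.eval_map, hy]
    have e := s.eval_map (DirectSum.component R I L i) (fun t => (w' t).1) j
    rw [h1', map_add] at e
    have e3 : DirectSum.component R I L i (DirectSum.lof R I L i (x j)) = x j :=
      DirectSum.component.lof_self R i (x j)
    rw [e3] at e
    exact (congrArg (· - b i (n j i)) e).trans (add_sub_cancel_right _ _)

end Amalgam

/-! ### Small distinguished hulls by Löwenheim–Skolem -/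

section Hull

/-- Take the substructure generated by `X` in the language whose function symbols are the given
operations. -/
lemma exists_closed_set {B O : Type u} {κ : Cardinal.{u}} (hκ : ℵ₀ ≤ κ) (hO : #O ≤ κ)
    (ar : O → ℕ) (op : ∀ o, (Fin (ar o) → B) → B) (X : Set B) (hX : #X ≤ κ) :
    ∃ N : Set B, X ⊆ N ∧ #N ≤ κ ∧ ∀ o (x : Fin (ar o) → B), (∀ i, x i ∈ N) → op o x ∈ N := by
  let L : FirstOrder.Language.{u, 0} := ⟨fun n => {o // ar o = n}, fun _ => Empty⟩
  let : L.Structure B :=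
    { funMap := fun f x => op f.1 fun i => x (Fin.cast f.2 i)
      RelMap := fun r => r.elim }
  let N := FirstOrder.Language.Substructure.closure L X
  refine ⟨N, FirstOrder.Language.Substructure.subset_closure, ?_, fun o x hx => ?_⟩
  · have h := FirstOrder.Language.Substructure.lift_card_closure_le (L := L) (s := X)
    rw [Cardinal.lift_id, Cardinal.lift_id, Cardinal.lift_id] at h
    refine h.trans (max_le hκ (Cardinal.add_le_of_le hκ hX ?_))
    exact (Cardinal.mk_congr (Equiv.sigmaFiberEquiv ar)).trans_le hO
  · exact N.fun_mem (⟨o, rfl⟩ : L.Functions (ar o)) x hx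

lemma mk_linSystem_le {R : Type u} {κ : Cardinal.{u}} (hκ : ℵ₀ ≤ κ) (hR : #R ≤ κ) : #(LinSystem R) ≤ κ := by
  have pow : ∀ (n : ℕ) (X : Type u), #X ≤ κ → #(Fin n → X) ≤ κ := fun n X hX => by
    have : #(Fin n → X) = #X ^ n := by simp
    rw [this]
    exact (pow_le_pow_left' hX n).trans (power_nat_le hκ)
  have sig : ∀ X : ℕ → Type u, (∀ n, #(X n) ≤ κ) → #(Σ n, X n) ≤ κ := fun X hX => by
    rw [mk_sigma]
    refine (sum_le_sum _ (fun _ : ℕ => κ) hX).trans ?_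
    rw [sum_const]
    simpa using mul_le_of_le hκ hκ le_rfl
  exact sig _ fun m => sig _ fun l => pow _ _ (pow _ _ hR)

variable {R : Type u} [Ring R]

/-- A Löwenheim–Skolem principle for modules: a small set is contained in a small submodule that is
closed under choosing solutions for each of a small family of conditions. -/
lemma exists_closed_submodule {B J : Type u} [AddCommGroup B] [Module R B] {κ : Cardinal.{u}}
    (hκ : ℵ₀ ≤ κ) (hR : #R ≤ κ) (hJ : #J ≤ κ) (m l : J → ℕ)
    (P : ∀ j, (Fin (m j) → B) → (Fin (l j) → B) → Prop) (X : Set B) (hX : #X ≤ κ) :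
    ∃ N : Submodule R B, X ⊆ N ∧ #N ≤ κ ∧ ∀ j x, (∀ i, x i ∈ N) → (∃ w, P j x w) →
      ∃ w, (∀ i, w i ∈ N) ∧ P j x w := by
  classical
  let sol : ∀ j, (Fin (m j) → B) → Fin (l j) → B := fun j x =>
    if h : ∃ w, P j x w then h.choose else 0
  -- One Skolem function for each coordinate of each chosen solution, together with the module
  -- operations; zero is put into the generating set below.
  let O := (Σ j, Fin (l j)) ⊕ (R ⊕ PUnit.{u + 1})
  let ar : O → ℕ := Sum.elim (fun p => m p.1) (Sum.elim (fun _ => 1) fun _ => 2)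
  let op : ∀ o, (Fin (ar o) → B) → B := fun o => match o with
    | .inl p => fun x => sol p.1 x p.2
    | .inr (.inl r) => fun x => r • (show Fin 1 → B from x) 0
    | .inr (.inr _) => fun x => (show Fin 2 → B from x) 0 + (show Fin 2 → B from x) 1
  have hO : #O ≤ κ := by
    have h1 : #(Σ j, Fin (l j)) ≤ κ := by
      have h2 : #(Σ j, Fin (l j)) ≤ #(J × ULift.{u} ℕ) := mk_le_of_injective
        (f := fun p => (p.1, ⟨p.2⟩)) fun ⟨j, i⟩ ⟨j', i'⟩ h => by
          obtain rfl : j = j' := congrArg Prod.fst h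
          exact congrArg _ (Fin.ext (congrArg (fun p => p.2.down) h))
      refine h2.trans ?_
      rw [mk_prod, lift_id, lift_id]
      exact mul_le_of_le hκ hJ (by simpa using hκ)
    rw [mk_sum, mk_sum, lift_id, lift_id, lift_id, lift_id]
    exact add_le_of_le hκ h1 (add_le_of_le hκ hR (by simpa using one_le_aleph0.trans hκ))
  obtain ⟨N, hXN, hN, hop⟩ := exists_closed_set hκ hO ar op (insert 0 X)
    ((mk_insert_le).trans (add_le_of_le hκ hX (one_le_aleph0.trans hκ)))
  refine ⟨⟨⟨⟨N, fun {a b} ha hb => ?_⟩, hXN (Set.mem_insert _ _)⟩, fun r x hx => ?_⟩,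
    (Set.subset_insert _ _).trans hXN, hN, fun j x hx hw => ⟨sol j x, fun i => ?_, ?_⟩⟩
  · exact hop (.inr (.inr ⟨⟩)) ![a, b] (Fin.forall_fin_two.2 ⟨ha, hb⟩)
  · exact hop (.inr (.inl r)) (fun _ => x) fun _ => hx
  · exact hop (.inl ⟨j, i⟩) x hx
  · simp only [sol, dif_pos hw]
    exact hw.choose_spec

variable {B : Type u} [AddCommGroup B] [Module R B] {k : EmbKind} {κ : Cardinal.{u}}

lemma EmbKind.exists_small_isSubmodule (k : EmbKind) (hκ : ℵ₀ ≤ κ) (hR : #R ≤ κ) (X : Set B)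
    (hX : #X ≤ κ) : ∃ N : Submodule R B, X ⊆ N ∧ #N ≤ κ ∧ k.IsSubmodule N := by
  obtain ⟨N, hXN, hN, h⟩ := exists_closed_submodule hκ hR (mk_linSystem_le hκ hR)
    (fun s => s.1) (fun s => s.2.1) (fun s x w => ∀ j, s.eval w j = x j) X hX
  exact ⟨N, hXN, hN, (k.isSubmodule_iff N).2 fun s _ a w ha hw => h s a ha ⟨w, hw⟩⟩

/-- Over a distinguished submodule `A`, a small set is contained in a small distinguished submodule
`N` such that `N ⊓ A` and `A ⊔ N` are distinguished, too. -/
lemma EmbKind.IsSubmodule.exists_small_compatible {A : Submodule R B} (hA : k.IsSubmodule A)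
    (hκ : ℵ₀ ≤ κ) (hR : #R ≤ κ) (X : Set B) (hX : #X ≤ κ) :
    ∃ N : Submodule R B, X ⊆ N ∧ #N ≤ κ ∧ k.IsSubmodule N ∧ k.IsSubmodule (N ⊓ A) ∧
      k.IsSubmodule (A ⊔ N) := by
  rw [k.isSubmodule_iff] at hA
  have hJ : #(LinSystem R × ULift.{u} Bool) ≤ κ := by
    rw [mk_prod, lift_id, lift_id]
    exact mul_le_of_le hκ (mk_linSystem_le hκ hR) ((lt_aleph0_of_finite _).le.trans hκ)
  -- Close under two kinds of choices: `true` gives solutions lying in `A`, `false` gives solutions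
  -- modulo `A`. A solution modulo `A` is then corrected by one within `N ⊓ A` (for `N`) or within
  -- `A` (for `A ⊔ N`).
  obtain ⟨N, hXN, hN, h⟩ := exists_closed_submodule hκ hR hJ (fun p => p.1.1) (fun p => p.1.2.1)
    (fun p x w => bif p.2.down then (∀ i, w i ∈ A) ∧ ∀ j, p.1.eval w j = x j
      else ∀ j, p.1.eval w j - x j ∈ A) X hX
  have eval_mem : ∀ (P : Submodule R B) (s : LinSystem R) (w : Fin s.2.1 → B), (∀ i, w i ∈ P) →
      ∀ j, s.eval w j ∈ P := fun P s w hw j => by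
    rw [s.eval_apply]
    exact P.sum_mem fun i _ => P.smul_mem _ (hw i)
  have hinf : k.IsSubmodule (N ⊓ A) := by
    refine (k.isSubmodule_iff _).2 fun s hs a w ha hw => ?_
    obtain ⟨v, hv, hva⟩ := hA s hs a w (fun j => (ha j).2) hw
    obtain ⟨u, hu, hu', hua⟩ := h ⟨s, ⟨true⟩⟩ a (fun j => (ha j).1) ⟨v, hv, hva⟩
    exact ⟨u, fun i => ⟨hu i, hu' i⟩, hua⟩
  refine ⟨N, hXN, hN, ?_, hinf, ?_⟩
  · refine (k.isSubmodule_iff _).2 fun s hs a w ha hw => ?_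
    obtain ⟨w', hw', hwa⟩ := h ⟨s, ⟨false⟩⟩ a ha ⟨w, fun j => by simp [hw]⟩
    obtain ⟨v, hv, hva⟩ := (k.isSubmodule_iff _).1 hinf s hs (fun j => s.eval w' j - a j) (w' - w)
      (fun j => ⟨N.sub_mem (eval_mem N s w' hw' j) (ha j), hwa j⟩) fun j => by simp [hw]
    exact ⟨w' - v, fun i => N.sub_mem (hw' i) (hv i).1, fun j => by simp [hva]⟩
  · refine (k.isSubmodule_iff _).2 fun s hs a w ha hw => ?_
    choose p hp x hx hpx using fun j => Submodule.mem_sup.1 (ha j)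
    obtain ⟨w', hw', hwa⟩ := h ⟨s, ⟨false⟩⟩ x hx
      ⟨w, fun j => by simpa [hw, ← hpx] using hp j⟩
    obtain ⟨v, hv, hva⟩ := hA s hs (fun j => p j - (s.eval w' j - x j)) (w - w')
      (fun j => A.sub_mem (hp j) (hwa j)) fun j => by simp [hw, ← hpx]; abel
    exact ⟨v + w', fun i => Submodule.add_mem_sup (hv i) (hw' i), fun j => by
      rw [map_add, Pi.add_apply, hva, ← hpx]; abel⟩

end Hull

/-! ### Saturated modules are relatively injective -/

section Saturated

variable {R : Type u} [Ring R] {K : ObjectProperty (ModuleCat.{u} R)} {k : EmbKind}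

lemma IsSaturated.exists_extension_of_small (hK : IsAdmissible K k) {M : ModuleCat.{u} R}
    {κ : Cardinal.{u}} (hκ : Order.succ (#R + ℵ₀) ≤ κ) (hM : IsSaturated K k κ M)
    {A L : Type u} [AddCommGroup A] [Module R A] [AddCommGroup L] [Module R L]
    (hL : K (ModuleCat.of R L)) (cL : #L ≤ #R + ℵ₀) (i : A →ₗ[R] L) (hi : k.IsEmbedding i)
    (g : A →ₗ[R] M) : ∃ h : L →ₗ[R] M, h ∘ₗ i = g := by
  have h0 : ℵ₀ ≤ #R + ℵ₀ := self_le_add_left _ _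
  have cA : #A ≤ #R + ℵ₀ := (mk_le_of_injective hi.injective).trans cL
  obtain ⟨N, hgN, cN, hN⟩ := k.exists_small_isSubmodule h0 (self_le_add_right _ _)
    (Set.range g) (mk_range_le.trans cA)
  have KN := hK.submodule M N hM.1 hN
  let g' : A →ₗ[R] N := g.codRestrict N fun a => hgN ⟨a, rfl⟩
  have hlt := (Order.lt_succ (#R + ℵ₀)).trans_le hκ
  obtain ⟨f, -, hf⟩ := (hM.2 N KN hN (cN.trans_lt hlt) _ hlt).2.2.2
    (ModuleCat.of R (Pushout i g')) (Pushout.inr i g') (hK.pushout hi g' hL KN)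
    (by
      refine mk_quotient_le.trans ?_
      rw [mk_prod, lift_id, lift_id]
      exact mul_le_of_le h0 cL cN)
    (hi.pushout_inr g')
  refine ⟨f ∘ₗ Pushout.inl i g', LinearMap.ext fun a => ?_⟩
  exact (congrArg f (Pushout.inl_comp i g' a)).trans (LinearMap.congr_fun hf (g' a))

/-- A system has finitely many parameters, so by directedness they all lie in the domain of one
member. -/
lemma EmbKind.isSubmodule_sSup {B M : Type u} [AddCommGroup B] [Module R B] [AddCommGroup M]
    [Module R M] {c : Set (B →ₗ.[R] M)} (hne : c.Nonempty) (hc : DirectedOn (· ≤ ·) c)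
    (h : ∀ p ∈ c, k.IsSubmodule p.domain) : k.IsSubmodule (LinearPMap.sSup c hc).domain := by
  refine (k.isSubmodule_iff _).2 fun s hs a w ha hw => ?_
  have : ∃ p ∈ c, ∀ j, a j ∈ p.domain := by
    simp only [LinearPMap.mem_domain_sSup_iff hne hc] at ha
    choose p hp hpa using ha
    have : Nonempty c := hne.to_subtype
    have : IsDirectedOrder c := directedOn_iff_isDirectedOrder.1 hc
    obtain ⟨q, hq⟩ := Finite.exists_le (fun j => (⟨p j, hp j⟩ : c))
    exact ⟨q, q.2, fun j => (hq j).1 (hpa j)⟩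
  obtain ⟨p, hp, hpa⟩ := this
  obtain ⟨v, hv, hva⟩ := (k.isSubmodule_iff _).1 (h p hp) s hs a w hpa hw
  exact ⟨v, fun i => (LinearPMap.le_sSup hc hp).1 (hv i), hva⟩

theorem IsSaturated.isRelInjective (hK : IsAdmissible K k) {M : ModuleCat.{u} R}
    {κ : Cardinal.{u}} (hκ : Order.succ (#R + ℵ₀) ≤ κ) (hM : IsSaturated K k κ M) :
    IsRelInjective K k M := by
  intro A B _ hB f hf g
  have h0 : ℵ₀ ≤ #R + ℵ₀ := self_le_add_left _ _
  let e := LinearEquiv.ofInjective f hf.injective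
  let p₀ : B →ₗ.[R] M := ⟨LinearMap.range f, g ∘ₗ (e.symm : _ →ₗ[R] A)⟩
  obtain ⟨p, hp₀, hp⟩ := zorn_le_nonempty₀ {p : B →ₗ.[R] M | k.IsSubmodule p.domain}
    (fun c hcS hc y hy => ⟨LinearPMap.sSup c hc.directedOn,
      EmbKind.isSubmodule_sSup ⟨y, hy⟩ hc.directedOn fun p hp => hcS hp,
      fun p hp => LinearPMap.le_sSup _ hp⟩) p₀ hf.isSubmodule_range
  have htop : ∀ b, b ∈ p.domain := by
    intro b
    obtain ⟨N, hbN, cN, hN, hNp, hpN⟩ := hp.1.exists_small_compatible h0 (self_le_add_right _ _)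
      {b} (by simpa using one_le_aleph0.trans h0)
    have hi : k.IsEmbedding (Submodule.inclusion (inf_le_left : N ⊓ p.domain ≤ N)) :=
      EmbKind.IsEmbedding.of_comp (g := N.subtype) hNp
    obtain ⟨h, hh⟩ := hM.exists_extension_of_small hK hκ (hK.submodule B N hB hN) cN _ hi
      (p.toFun ∘ₗ Submodule.inclusion inf_le_right)
    let q : B →ₗ.[R] M := ⟨N, h⟩
    have hpq : ∀ (x : p.domain) (y : q.domain), (x : B) = y → p x = q y := by
      rintro ⟨x, hx⟩ ⟨_, hy⟩ rfl
      exact (LinearMap.congr_fun hh ⟨x, hy, hx⟩).symm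
    -- The glued map has the distinguished domain `p.domain ⊔ N`, so maximality forces `N ≤
    -- p.domain`.
    exact (hp.2 (y := p.sup q hpq) hpN (LinearPMap.left_le_sup _ _ _)).1
      ((LinearPMap.right_le_sup p q hpq).1 (hbN rfl))
  refine ⟨p.toFun ∘ₗ LinearMap.id.codRestrict p.domain htop, LinearMap.ext fun a => ?_⟩
  have : p₀ (e a) = p ⟨f a, htop _⟩ := hp₀.2 rfl
  refine this.symm.trans ?_
  exact congrArg g (e.symm_apply_apply a)

end Saturated

/-! ### Realizing all small extensions in one step -/

section OneStep

variable {R : Type u} [Ring R] {K : ObjectProperty (ModuleCat.{u} R)} {k : EmbKind}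

/-- Quotients of one fixed free module represent all modules of size at most `κ`, so the extensions
to be amalgamated are indexed by a type in `Type u`. -/
lemma exists_quotient_equiv {κ : Cardinal.{u}} (N : Type u) [AddCommGroup N] [Module R N]
    (hN : #N ≤ κ) : ∃ S : Submodule R (κ.out →₀ R), Nonempty (((κ.out →₀ R) ⧸ S) ≃ₗ[R] N) := by
  obtain ⟨i⟩ : Nonempty (N ↪ κ.out) := by rwa [← le_def, mk_out]
  have hsurj := Function.invFun_surjective i.injective
  let f := Finsupp.linearCombination R (Function.invFun i)
  exact ⟨LinearMap.ker f, ⟨f.quotKerEquivOfSurjective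
    (Finsupp.linearCombination_surjective R hsurj)⟩⟩

/-- Any family of embeddings `b i : N i → L i` can be amalgamated over embeddings `N i → M`. -/
lemma IsAdmissible.exists_amalgam (hK : IsAdmissible K k) {I : Type u} {N L : I → Type u}
    [∀ i, AddCommGroup (N i)] [∀ i, Module R (N i)] [∀ i, AddCommGroup (L i)]
    [∀ i, Module R (L i)] {M : ModuleCat.{u} R} (hM : K M) (hL : ∀ i, K (ModuleCat.of R (L i)))
    {a : ∀ i, N i →ₗ[R] M} {b : ∀ i, N i →ₗ[R] L i} (ha : ∀ i, k.IsEmbedding (a i))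
    (hb : ∀ i, k.IsEmbedding (b i)) :
    ∃ (M' : ModuleCat.{u} R) (φ : M ⟶ M'), K M' ∧ k.IsEmbedding φ.hom ∧
      ∀ i, ∃ f : L i →ₗ[R] M', k.IsEmbedding f ∧ f ∘ₗ b i = φ.hom ∘ₗ a i := by
  classical
  have hf := EmbKind.IsEmbedding.lmap hb
  refine ⟨ModuleCat.of R (Pushout (DirectSum.lmap b) (DirectSum.toModule R I M a)),
    ModuleCat.ofHom (Pushout.inr _ _),
    hK.pushout hf _ (hK.directSum I (fun i => ModuleCat.of R (L i)) hL) hM,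
    hf.pushout_inr _, fun i => ⟨_, EmbKind.IsEmbedding.amalgam hb i (ha i), ?_⟩⟩
  refine LinearMap.ext fun y => ?_
  have e := Pushout.inl_comp (DirectSum.lmap b) (DirectSum.toModule R I M a)
    (DirectSum.lof R I N i y)
  rw [DirectSum.lmap_lof, DirectSum.toModule_lof] at e
  exact e

/-- Every module `M` in `K` has an extension in `K` that realizes all extensions of cardinality at
most `κ` of small distinguished submodules of `M`. -/
theorem IsAdmissible.exists_universal_extension (hK : IsAdmissible K k) (κ : Cardinal.{u})
    (M : ModuleCat.{u} R) (hM : K M) :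
    ∃ (M' : ModuleCat.{u} R) (φ : M ⟶ M'), K M' ∧ k.IsEmbedding φ.hom ∧
      ∀ (N L : Type u) [AddCommGroup N] [Module R N] [AddCommGroup L] [Module R L]
        (a : N →ₗ[R] M) (b : N →ₗ[R] L), k.IsEmbedding a → k.IsEmbedding b →
        K (ModuleCat.of R L) → #L ≤ κ →
        ∃ f : L →ₗ[R] M', k.IsEmbedding f ∧ f ∘ₗ b = φ.hom ∘ₗ a := by
  let F := κ.out →₀ R
  let I := Σ (S₁ : Submodule R F) (S₂ : Submodule R F),
    {p : ((F ⧸ S₁) →ₗ[R] M) × ((F ⧸ S₁) →ₗ[R] F ⧸ S₂) //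
      k.IsEmbedding p.1 ∧ k.IsEmbedding p.2 ∧ K (ModuleCat.of R (F ⧸ S₂))}
  obtain ⟨M', φ, hM', hφ, h⟩ := hK.exists_amalgam (I := I) (N := fun i => F ⧸ i.1)
    (L := fun i => F ⧸ i.2.1) hM (fun i => i.2.2.2.2.2) (a := fun i => i.2.2.1.1)
    (b := fun i => i.2.2.1.2) (fun i => i.2.2.2.1) (fun i => i.2.2.2.2.1)
  refine ⟨M', φ, hM', hφ, ?_⟩
  intro N L _ _ _ _ a b ha hb hL cL
  obtain ⟨S₁, ⟨e₁⟩⟩ := exists_quotient_equiv (R := R) N ((mk_le_of_injective hb.injective).trans cL)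
  obtain ⟨S₂, ⟨e₂⟩⟩ := exists_quotient_equiv (R := R) L cL
  obtain ⟨f, hf, hfb⟩ := h ⟨S₁, S₂, ⟨(a ∘ₗ (e₁ : _ →ₗ[R] N),
    (e₂.symm : L →ₗ[R] _) ∘ₗ b ∘ₗ (e₁ : _ →ₗ[R] N)),
    ha.comp (k.isEmbedding_of_equiv e₁),
    (k.isEmbedding_of_equiv e₂.symm).comp (hb.comp (k.isEmbedding_of_equiv e₁)),
    hK.of_equiv e₂.symm hL⟩⟩
  refine ⟨f ∘ₗ (e₂.symm : L →ₗ[R] _), hf.comp (k.isEmbedding_of_equiv e₂.symm),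
    LinearMap.ext fun x => ?_⟩
  obtain ⟨y, rfl⟩ := e₁.surjective x
  exact LinearMap.congr_fun hfb y

end OneStep

/-! ### Colimits of chains of 𝓜-embeddings -/

section Chain

variable {R : Type u} [Ring R] {K : ObjectProperty (ModuleCat.{u} R)} {k : EmbKind}

open Limits

lemma exists_common_rep {J : Type u} [LinearOrder J] [Nonempty J] {F : J ⥤ ModuleCat.{u} R}
    {c : Cocone F} (hc : IsColimit c) {T : Type*} [Finite T] (x : T → c.pt) (i : J) :
    ∃ j, i ≤ j ∧ ∀ t, ∃ y : F.obj j, (c.ι.app j).hom y = x t := by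
  choose j y hy using fun t => Concrete.isColimit_exists_rep F hc (x t)
  obtain ⟨m, hm⟩ := Finite.exists_le j
  refine ⟨max i m, le_max_left _ _, fun t =>
    ⟨(F.map (homOfLE ((hm t).trans (le_max_right i m)))).hom (y t), ?_⟩⟩
  rw [← hy t, ← c.w (homOfLE ((hm t).trans (le_max_right i m)))]
  rfl

variable {J : Type u} [LinearOrder J] [Nonempty J] {F : J ⥤ ModuleCat.{u} R} {c : Cocone F}

lemma injective_ι (hc : IsColimit c) (hmap : ∀ ⦃i j⦄ (h : i ⟶ j), k.IsEmbedding (F.map h).hom)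
    (j : J) : Function.Injective (c.ι.app j).hom := by
  intro x y hxy
  obtain ⟨i, f, g, h⟩ := Concrete.isColimit_exists_of_rep_eq F hc x y hxy
  obtain rfl := Subsingleton.elim f g
  exact (hmap f).injective h

/-- A solution in the colimit has finitely many entries, so it already lives at some later stage,
and the transition map reflects it. -/
lemma isEmbedding_ι (hc : IsColimit c) (hmap : ∀ ⦃i j⦄ (h : i ⟶ j), k.IsEmbedding (F.map h).hom)
    (j : J) : k.IsEmbedding (c.ι.app j).hom := by
  refine (k.isEmbedding_iff _).2 ⟨injective_ι hc hmap j, fun s hs a w hw => ?_⟩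
  obtain ⟨i, hji, hi⟩ := exists_common_rep hc w j
  choose y hy using hi
  refine (hmap (homOfLE hji)).exists_eval_eq hs a y fun t => injective_ι hc hmap i ?_
  rw [← s.eval_map, funext hy, hw t, ← c.w (homOfLE hji)]
  rfl

omit [LinearOrder J] [Nonempty J] in
-- The images in `P` of a solution `w` come from a tuple `y` in a single `X j`. When the right-hand
-- side is in the kernel, `y` solves the homogeneous system, so `w` minus the copy of `y` is a
-- solution in the kernel.
lemma EmbKind.isEpi_toModule [DecidableEq J] {X : J → Type u} [∀ j, AddCommGroup (X j)]
    [∀ j, Module R (X j)] {P : Type u} [AddCommGroup P] [Module R P] (p : ∀ j, X j →ₗ[R] P)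
    (hp : ∀ j, Function.Injective (p j))
    (hrep : ∀ (n : ℕ) (x : Fin n → P), ∃ j, ∀ t, ∃ y, p j y = x t) :
    k.IsEpi (DirectSum.toModule R J P p) := by
  refine ⟨fun x => ?_, (k.isSubmodule_iff _).2 fun s _ a w ha hw => ?_⟩
  · obtain ⟨j, hj⟩ := hrep 1 fun _ => x
    obtain ⟨y, hy⟩ := hj 0
    exact ⟨DirectSum.lof R J X j y, (DirectSum.toModule_lof R j y).trans hy⟩
  · obtain ⟨j, hj⟩ := hrep _ fun t => DirectSum.toModule R J P p (w t)
    choose y hy using hj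
    have hy0 : ∀ t, s.eval y t = 0 := fun t => hp j <| by
      rw [← s.eval_map, funext hy, s.eval_map, hw t, map_zero]
      exact ha t
    refine ⟨w - fun t => DirectSum.lof R J X j (y t), fun t => ?_, fun t => ?_⟩
    · rw [LinearMap.mem_ker, Pi.sub_apply, map_sub, DirectSum.toModule_lof, hy, sub_self]
    · rw [map_sub, Pi.sub_apply, s.eval_map, hy0, hw, map_zero, sub_zero]

lemma IsAdmissible.colimit (hK : IsAdmissible K k) (hc : IsColimit c) (hF : ∀ j, K (F.obj j))
    (hmap : ∀ ⦃i j⦄ (h : i ⟶ j), k.IsEmbedding (F.map h).hom) : K c.pt := by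
  classical
  refine hK.epi _ c.pt _ (hK.directSum J F.obj hF)
    (k.isEpi_toModule (fun j => (c.ι.app j).hom) (injective_ι hc hmap) fun n x => ?_)
  obtain ⟨j, -, hj⟩ := exists_common_rep hc x (Classical.arbitrary J)
  exact ⟨j, hj⟩

end Chain

/-! ### Transfinite iteration and existence of saturated extensions -/

section Iteration

variable {R : Type u} [Ring R] {K : ObjectProperty (ModuleCat.{u} R)} {k : EmbKind}

open Limits SmallObject

lemma EmbKind.isEmbedding_of_iso {A B : ModuleCat.{u} R} (e : A ≅ B) : k.IsEmbedding e.hom.hom :=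
  k.isEmbedding_of_equiv e.toLinearEquiv

lemma EmbKind.isEmbedding_map_self {J : Type u} [Preorder J] (F : J ⥤ ModuleCat.{u} R) {j : J}
    (h : j ≤ j) : k.IsEmbedding (F.map (homOfLE h)).hom := by
  rw [Subsingleton.elim (homOfLE h) (𝟙 j), F.map_id]
  exact k.isEmbedding_of_iso (Iso.refl _)

lemma EmbKind.IsEmbedding.comp_hom {A B C : ModuleCat.{u} R} {f : A ⟶ B} {g : B ⟶ C}
    (hf : k.IsEmbedding f.hom) (hg : k.IsEmbedding g.hom) : k.IsEmbedding (f ≫ g).hom := by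
  rw [ModuleCat.hom_comp]
  exact hg.comp hf

lemma EmbKind.IsSubmodule.exists_lift {A B : Type u} [AddCommGroup A] [Module R A]
    [AddCommGroup B] [Module R B] {N : Submodule R B} (hN : k.IsSubmodule N) {f : A →ₗ[R] B}
    (hf : Function.Injective f) (h : N ≤ LinearMap.range f) : ∃ a : N →ₗ[R] A, k.IsEmbedding a ∧ f ∘ₗ a = N.subtype := by
  let e := LinearEquiv.ofInjective f hf
  have ha : f ∘ₗ (e.symm : _ →ₗ[R] A) ∘ₗ Submodule.inclusion h = N.subtype :=
    LinearMap.ext fun n => congrArg Subtype.val (e.apply_symm_apply (Submodule.inclusion h n))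
  exact ⟨_, EmbKind.IsEmbedding.of_comp (g := f) ((congrArg k.IsEmbedding ha).mpr hN), ha⟩

/-- If a successor structure consists of distinguished embeddings in `K`, then so do its transfinite
iterations. -/
lemma IsAdmissible.iterationFunctor (hK : IsAdmissible K k) (Φ : SuccStruct (ModuleCat.{u} R))
    (h₀ : K Φ.X₀) (hs : ∀ X, K X → K (Φ.succ X) ∧ k.IsEmbedding (Φ.toSucc X).hom)
    {J : Type u} [LinearOrder J] [OrderBot J] [SuccOrder J] [WellFoundedLT J] (j : J) :
    K ((Φ.iterationFunctor J).obj j) ∧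
      ∀ (i : J) (h : i ≤ j), k.IsEmbedding ((Φ.iterationFunctor J).map (homOfLE h)).hom := by
  induction j using SuccOrder.limitRecOn with
  | isMin j hj =>
    obtain rfl := hj.eq_bot
    refine ⟨hK.of_equiv (Φ.iterationFunctorObjBotIso J).symm.toLinearEquiv h₀, fun i h => ?_⟩
    obtain rfl := le_bot_iff.1 h
    exact k.isEmbedding_map_self _ h
  | succ j hj ih =>
    obtain ⟨hj₁, hj₂⟩ := hs _ ih.1
    refine ⟨hK.of_equiv (Φ.iterationFunctorObjSuccIso j hj).symm.toLinearEquiv hj₁, fun i h => ?_⟩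
    rcases h.lt_or_eq with h' | rfl
    · have hij : i ≤ j := (Order.lt_succ_iff_of_not_isMax hj).1 h'
      rw [show homOfLE h = homOfLE hij ≫ homOfLE (Order.le_succ j) from rfl, Functor.map_comp,
        Φ.iterationFunctor_map_succ j hj]
      exact (ih.2 i hij).comp_hom (hj₂.comp_hom
        (k.isEmbedding_of_iso (Φ.iterationFunctorObjSuccIso j hj).symm))
    · exact k.isEmbedding_map_self _ h
  | isSuccLimit j hj ih =>
    have hc := (Φ.iterationFunctor J).isColimitOfIsWellOrderContinuous j hj
    have : Nonempty (Set.Iio j) := ⟨⟨⊥, hj.bot_lt⟩⟩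
    have hmap : ∀ ⦃a b : Set.Iio j⦄ (h : a ⟶ b), k.IsEmbedding
        (((Set.principalSegIio j).monotone.functor ⋙ Φ.iterationFunctor J).map h).hom :=
      fun a b h => (ih b b.2).2 a (leOfHom h)
    refine ⟨hK.colimit hc (fun i => (ih i i.2).1) hmap, fun i h => ?_⟩
    rcases h.lt_or_eq with h' | rfl
    · exact isEmbedding_ι hc hmap ⟨i, h'⟩
    · exact k.isEmbedding_map_self _ h

/-- Every module in `K` has a distinguished extension that is saturated. -/
theorem IsAdmissible.exists_isSaturated (hK : IsAdmissible K k) {κ : Cardinal.{u}} (hκ : ℵ₀ ≤ κ)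
    (A : ModuleCat.{u} R) (hA : K A) :
    ∃ (M : ModuleCat.{u} R) (f : A ⟶ M), IsSaturated K k (Order.succ κ) M ∧
      k.IsEmbedding f.hom := by
  have key : ∀ X : ModuleCat.{u} R, ∃ (X' : ModuleCat.{u} R) (φ : X ⟶ X'), K X →
      K X' ∧ k.IsEmbedding φ.hom ∧
      ∀ (N L : Type u) [AddCommGroup N] [Module R N] [AddCommGroup L] [Module R L]
        (a : N →ₗ[R] X) (b : N →ₗ[R] L), k.IsEmbedding a → k.IsEmbedding b →
        K (ModuleCat.of R L) → #L ≤ κ →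
        ∃ f : L →ₗ[R] X', k.IsEmbedding f ∧ f ∘ₗ b = φ.hom ∘ₗ a := fun X => by
    by_cases hX : K X
    · obtain ⟨X', φ, h⟩ := hK.exists_universal_extension κ X hX
      exact ⟨X', φ, fun _ => h⟩
    -- A successor structure needs a value on every module; outside `K` it is irrelevant.
    · exact ⟨X, 𝟙 X, fun h => (hX h).elim⟩
  choose S φ hS using key
  let Φ : SuccStruct (ModuleCat.{u} R) := ⟨A, S, φ⟩
  have hreg : Fact (Order.succ κ).IsRegular := ⟨isRegular_succ hκ⟩
  let J := (Order.succ κ).ord.ToType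
  have hJ : Nonempty J := by simp [J]
  let _ : OrderBot J := WellFoundedLT.toOrderBot J
  let _ : SuccOrder J := SuccOrder.ofLinearWellFoundedLT J
  have : NoMaxOrder J := noMaxOrder (hκ.trans (Order.le_succ κ))
  have hΦ := hK.iterationFunctor Φ hA (fun X hX => ⟨(hS X hX).1, (hS X hX).2.1⟩) (J := J)
  have hc := Φ.isColimitIterationCocone J
  have hmap : ∀ ⦃i j : J⦄ (h : i ⟶ j), k.IsEmbedding ((Φ.iterationFunctor J).map h).hom :=
    fun i j h => (hΦ j).2 i (leOfHom h)
  have hι := isEmbedding_ι hc hmap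
  have KM : K (Φ.iteration J) := hK.colimit hc (fun j => (hΦ j).1) hmap
  refine ⟨Φ.iteration J, Φ.ιIteration J, ⟨KM, fun N KN hN cN μ hμ => ⟨KM, KN, hN, ?_⟩⟩,
    (k.isEmbedding_of_iso (Φ.iterationFunctorObjBotIso J).symm).comp_hom (hι ⊥)⟩
  intro L i KL cL hi
  -- By regularity of `Order.succ κ`, the stages at which the fewer than `Order.succ κ` elements of
  -- `N` appear have a common upper bound.
  obtain ⟨j, hj⟩ : ∃ j, ∀ n : N, ∃ y, ((Φ.iterationCocone J).ι.app j).hom y = (n : Φ.iteration J) := by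
    choose j y hy using fun n : N => Concrete.isColimit_exists_rep _ hc (n : Φ.iteration J)
    have hlt : HasCardinalLT N (Order.succ κ) := by rwa [hasCardinalLT_iff_cardinal_mk_lt]
    refine ⟨IsCardinalFiltered.max j hlt,
      fun n => ⟨((Φ.iterationFunctor J).map (IsCardinalFiltered.toMax j hlt n)).hom (y n), ?_⟩⟩
    rw [← hy n, ← (Φ.iterationCocone J).w (IsCardinalFiltered.toMax j hlt n)]
    rfl
  let ι : (Φ.iterationFunctor J).obj j ⟶ Φ.iteration J := (Φ.iterationCocone J).ι.app j
  obtain ⟨a, ha', ha⟩ := hN.exists_lift (f := ι.hom) (hι j).injective fun n hn => hj ⟨n, hn⟩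
  -- `N` now sits inside stage `j`, so `L` embeds over it into the next stage.
  obtain ⟨f, hf, hfa⟩ := (hS _ (hΦ j).1).2.2 N L a i ha' hi KL
    (cL.trans (Order.lt_succ_iff.1 hμ))
  have hjm := not_isMax j
  let ψ : Φ.succ _ ⟶ Φ.iteration J :=
    (Φ.iterationFunctorObjSuccIso j hjm).inv ≫ (Φ.iterationCocone J).ι.app (Order.succ j)
  have hψ : k.IsEmbedding ψ.hom :=
    (k.isEmbedding_of_iso (Φ.iterationFunctorObjSuccIso j hjm).symm).comp_hom (hι _)
  have hφψ : Φ.toSucc _ ≫ ψ = ι := by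
    refine Eq.trans ?_ ((Φ.iterationCocone J).w (homOfLE (Order.le_succ j)))
    rw [Φ.iterationFunctor_map_succ j hjm, Category.assoc]
    rfl
  refine ⟨ψ.hom ∘ₗ f, hψ.comp hf, LinearMap.ext fun x => ?_⟩
  exact ((congrArg ψ.hom (LinearMap.congr_fun hfa x)).trans
    (LinearMap.congr_fun (congrArg ModuleCat.Hom.hom hφψ) (a x))).trans (LinearMap.congr_fun ha x)

end Iteration

/-! ### Retracts of injectives -/

section Retract

variable {R : Type u} [Ring R] {K : ObjectProperty (ModuleCat.{u} R)} {k : EmbKind}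

lemma IsRelInjective.of_retract {E M : ModuleCat.{u} R} (hM : IsRelInjective K k M)
    (r : Retract E M) : IsRelInjective K k E := by
  intro A B hA hB f hf g
  obtain ⟨h, hh⟩ := hM A B hA hB f hf (r.i.hom ∘ₗ g)
  refine ⟨r.r.hom ∘ₗ h, ?_⟩
  rw [LinearMap.comp_assoc, hh, ← LinearMap.comp_assoc, ← ModuleCat.hom_comp, r.retract]
  rfl

end Retract

end RelInj

theorem mainTheorem9 (R : Type u) [Ring R]
    (K : CategoryTheory.ObjectProperty (ModuleCat.{u} R)) (k : RelInj.EmbKind)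
    (hK : RelInj.IsAdmissible K k) :
    (∀ E : ModuleCat.{u} R, K E →
      (RelInj.IsRelInjective K k E ↔
        ∃ M : ModuleCat.{u} R,
          RelInj.IsSaturated K k (Order.succ (Cardinal.mk R + Cardinal.aleph0)) M ∧
            Nonempty (CategoryTheory.Retract E M))) ∧
    (∀ (M : ModuleCat.{u} R) (κ : Cardinal.{u}),
      Order.succ (Cardinal.mk R + Cardinal.aleph0) ≤ κ →
        RelInj.IsSaturated K k κ M → RelInj.IsRelInjective K k M) ∧
    (∀ A : ModuleCat.{u} R, K A →
      ∃ (B : ModuleCat.{u} R) (f : A →ₗ[R] B),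
        K B ∧ k.IsEmbedding f ∧ RelInj.IsRelInjective K k B) := by
  have h0 : Cardinal.aleph0 ≤ Cardinal.mk R + Cardinal.aleph0 := self_le_add_left _ _
  refine ⟨fun E hE => ⟨fun hinj => ?_, ?_⟩, fun M κ hκ hM => hM.isRelInjective hK hκ, fun A hA => ?_⟩
  · obtain ⟨M, f, hM, hf⟩ := hK.exists_isSaturated h0 E hE
    obtain ⟨g, hg⟩ := hinj E M hE hM.1 f.hom hf LinearMap.id
    exact ⟨M, hM, ⟨⟨f, ModuleCat.ofHom g, ModuleCat.hom_ext hg⟩⟩⟩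
  · rintro ⟨M, hM, ⟨r⟩⟩
    exact (hM.isRelInjective hK le_rfl).of_retract r
  · obtain ⟨M, f, hM, hf⟩ := hK.exists_isSaturated h0 A hA
    exact ⟨M, f.hom, hM.1, hf, hM.isRelInjective hK le_rfl⟩
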